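/- **Graphs.** Let $[N]=\{1,\dots,N\}$ and let $\log$ denote the logarithm to base $2$. For a function $r$ from $[N]$ to the non-negative integers, let $G_r$ be the directed acyclic graph on $[N]$ with the edges $(i,i+1)$ for $1\le i<N$ and the edges $(r(i),i)$ for all $i\in[N]$ with $1\le r(i)<i$. A *random Argon2i-A graph* on $[N]$ is $G_r$ with independent values $r(i)$, where $r(i)$ is uniform on $\{1,\dots,i-2\}$ for $i\ge 3$, and there is no edge $(r(i),i)$ for $i\le 2$. A *random Argon2i-B graph* on $[N]$ is $G_r$ with independent values $r(i)$ distributed by $$\Pr[r(i)=j]=\Pr_{x}\left[\,i\left(1-\tfrac{x^2}{N^2}\right)\in(j-1,j]\,\right],\qquad x \text{ uniform on } [N],\quad j=0,1,\dots,i,$$ where the outcomes $r(i)=0$ and $r(i)=i$ give no edge. **Quantum pebbling.** For a directed acyclic graph $G=(V,E)$ and $W\subseteq V$, let $\mathrm{parents}(W)=\{u:(u,w)\in E\text{ for some }w\in W\}$, and let $\mathrm{sinks}(G)$ be the set of nodes without outgoing edges. A legal parallel quantum pebbling of $G$ is a sequence $P=(P_0,\dots,P_t)$ of subsets of $V$ with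 $P_0=\varnothing$ and $P_t=\mathrm{sinks}(G)$ such that for each $1\le i\le t$ $$\mathrm{parents}(P_i\setminus P_{i-1})\cup\mathrm{parents}(P_{i-1}\setminus P_i)\subseteq P_{i-1}\cap P_i .$$ Its space-time cost is $t\cdot\max_{1\le i\le t}|P_i|$, and the parallel quantum space-time complexity $\Pi_{st}(G)$ is the minimum of this cost over all legal parallel quantum pebblings of $G$. **Statement.** There is an absolute constant $C>0$ such that, with high probability, a random Argon2i-A graph $G_A$ on $[N]$ and a random Argon2i-B graph $G_B$ on $[N]$ satisfy $$\Pi_{st}(G_A)\le C\,\frac{N^2\log\log N}{\sqrt{\log N}}\qquad\text{and}\qquad \Pi_{st}(G_B)\le C\,\frac{N^2}{\sqrt[3]{\log N}},$$ respectively. Here "with high probability" means: for every $c>0$, each of the two bounds holds with probability at least $1-N^{-c}$ for all sufficiently large $N$. -/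

import Mathlib

open Filter MeasureTheory
open scoped ENNReal

noncomputable section

namespace QuantumPebbling

/-! ### The parallel quantum pebbling game -/

section Game

variable {V : Type*}

/-- The parents of a set `W` of nodes: all `u` with an edge `(u, w)`, `w ∈ W`. -/
def parents (G : Digraph V) (W : Set V) : Set V :=
  {u | ∃ w ∈ W, G.Adj u w}

/-- The nodes without outgoing edges. -/
def sinks (G : Digraph V) : Set V :=
  {v | ¬ ∃ u, G.Adj v u}

/-- A legal parallel quantum pebbling `(P₀, …, P_t)` of the target set `T`. The values `conf i`
with `i > time` play no role. -/
structure Pebbling (G : Digraph V) (T : Set V) where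
  /-- The number `t` of rounds. -/
  time : ℕ
  /-- The configurations `P i`. -/
  conf : ℕ → Finset V
  start : conf 0 = ∅
  /-- The pebbling ends with pebbles exactly on the target nodes. -/
  finish : (conf time : Set V) = T
  /-- A pebble is added only if all its parents were pebbled in the previous round. -/
  add_legal : ∀ i < time, ∀ x ∈ (conf (i + 1) : Set V) \ conf i,
    parents G {x} ⊆ conf i
  /-- No-deletion: a pebble is removed only if all its parents were pebbled in the previous
  round. -/
  delete_legal : ∀ i < time, ∀ x ∈ (conf i : Set V) \ conf (i + 1),
    parents G {x} ⊆ conf i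
  /-- Reversibility: pebbles that were used to add or remove pebbles are kept. -/
  reversible : ∀ i < time,
    parents G ((conf (i + 1) : Set V) \ conf i) ∪ parents G ((conf i : Set V) \ conf (i + 1))
      ⊆ conf (i + 1)

/-- The space cost `max_{1 ≤ i ≤ t} |P_i|`. -/
def Pebbling.space {G : Digraph V} {T : Set V} (P : Pebbling G T) : ℕ :=
  (Finset.Icc 1 P.time).sup fun i => (P.conf i).card

/-- The space-time cost: number of rounds times space. -/
def Pebbling.spaceTime {G : Digraph V} {T : Set V} (P : Pebbling G T) : ℕ :=
  P.time * P.space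

/-- The parallel quantum space-time complexity of `G`: the least space-time cost of a legal parallel
quantum pebbling of the sinks of `G` (`⊤` if there is none). -/
def spaceTimeComplexity (G : Digraph V) : ℕ∞ :=
  ⨅ P : Pebbling G (sinks G), (P.spaceTime : ℕ∞)

end Game

/-! ### Argon2i graphs -/

/-- The node set `[N] = {1, …, N}`. -/
abbrev Node (N : ℕ) : Type := {v : ℕ // v ∈ Finset.Icc 1 N}

/-- The graph on `[N]` with the edges `(i, i + 1)` and `(r i, i)`. A value `r i` outside
`{1, …, i - 1}` contributes no edge (the pair would not be an edge of a directed acyclic graph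
on `[N]`). -/
def argonGraph {N : ℕ} (r : Node N → ℕ) : Digraph (Node N) where
  Adj u v := (v : ℕ) = u + 1 ∨ ((u : ℕ) = r v ∧ (u : ℕ) < v)

/-- Argon2i-A: `r i` is uniform on `{1, …, i - 2}`; for `i ≤ 2` this set is empty, and the value
`0` stands for "no edge". -/
def argonALaw (i : ℕ) : PMF ℕ :=
  if h : (Finset.Icc 1 (i - 2)).Nonempty then PMF.uniformOfFinset (Finset.Icc 1 (i - 2)) h
  else PMF.pure 0

/-- Argon2i-B: `r i = j` iff `i (1 - x² / N²) ∈ (j - 1, j]`, where `x` is uniform on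
`{1, …, N}`. -/
def argonBLaw {N : ℕ} (i : Node N) : PMF ℕ :=
  (PMF.uniformOfFinset (Finset.Icc 1 N) ⟨i, i.2⟩).map
    fun x => ⌈(i : ℝ) * (1 - (x : ℝ) ^ 2 / (N : ℝ) ^ 2)⌉₊

/-- The joint law of the independent choices `r i`, `i ∈ [N]`, for Argon2i-A. -/
def argonA (N : ℕ) : Measure (Node N → ℕ) :=
  Measure.pi fun i => (argonALaw i).toMeasure

/-- The joint law of the independent choices `r i`, `i ∈ [N]`, for Argon2i-B. -/
def argonB (N : ℕ) : Measure (Node N → ℕ) :=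
  Measure.pi fun i => (argonBLaw i).toMeasure

/-- The events `E N` hold with high probability: for every `c > 0`, with probability at least
`1 - N ^ (-c)` for all large `N`. -/
def WithHighProbability {Ω : ℕ → Type*} [∀ N, MeasurableSpace (Ω N)]
    (μ : ∀ N, Measure (Ω N)) (E : ∀ N, Set (Ω N)) : Prop :=
  ∀ c : ℝ, 0 < c → ∀ᶠ N : ℕ in atTop, 1 - (N : ℝ) ^ (-c) ≤ (μ N).real (E N)

end QuantumPebbling

end

/-! Suppose a set `S` of nodes can be removed so that every remaining path has fewer than `d` edges.
Since indegrees are at most 2, a block of `b` nodes has at most `b * 2 ^ (d + 1)` ancestors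
reachable without meeting `S`, and these can be pebbled in `d` rounds once the earlier part of `S`
is pebbled. Legal rounds are reversible, so after a block is pebbled everything outside `S` can be
uncomputed. Block after block this reaches `S`; the reversed run with the sink held fixed then
clears all else. With `b` about `√N` and `d` at most a quarter of `log N`, the time is `O(N)` and
the space is `|S|` plus lower-order terms (`spaceTimeComplexity_le_of_depthReducing`).

To build `S`, cut `[N]` into `q` layers of length `ℓ`; put into `S` the multiples of `m` and the
nodes whose random parent lies in their own layer. Remaining paths have depth at most `q * m`
(`spaceTimeComplexity_le_of_layers`). The number of same-layer parents is a sum of independent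
indicators, controlled by its mean and a Chernoff bound. The mean is at most `ℓ (1 + ln (N / ℓ))`
for Argon2i-A and `2 √(ℓ N)` for Argon2i-B. Balancing against `N / m` under `q m ≲ log N` gives `q =
m ≈ √(log N)` for A, and `q = m²`, `m ≈ (log N)^(1/3)` for B. -/

namespace QuantumPebbling

/-! ### Reachability of configurations -/

section Reachability

variable {V : Type*} {G : Digraph V}

/-- A legal round of the parallel quantum pebbling game. -/
def Step (G : Digraph V) (P Q : Finset V) : Prop :=
  ∀ x, (x ∈ P ∧ x ∉ Q ∨ x ∈ Q ∧ x ∉ P) → ∀ u, G.Adj u x → u ∈ P ∧ u ∈ Q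

/-- `Q` can be reached from `P` in `t` rounds using at most `s` pebbles. -/
def Reach (G : Digraph V) (s t : ℕ) (P Q : Finset V) : Prop :=
  ∃ f : ℕ → Finset V, f 0 = P ∧ f t = Q ∧ (∀ i < t, Step G (f i) (f (i + 1))) ∧
    ∀ i ≤ t, (f i).card ≤ s

/-- Additions and deletions obey the same rule; every uncomputation below rests on this symmetry. -/
theorem Step.symm {P Q : Finset V} (h : Step G P Q) : Step G Q P :=
  fun x hx u hu => (h x hx.symm u hu).symm

theorem Reach.symm {s t : ℕ} {P Q : Finset V} (h : Reach G s t P Q) : Reach G s t Q P := by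
  obtain ⟨f, h0, ht, hs, hc⟩ := h
  refine ⟨fun i => f (t - i), by simpa using ht, by simpa using h0, fun i hi => ?_,
    fun i _ => hc _ (Nat.sub_le _ _)⟩
  have := (hs (t - (i + 1)) (by omega)).symm
  rwa [show t - (i + 1) + 1 = t - i by omega] at this

theorem Reach.trans {s t t' : ℕ} {P Q R : Finset V} (h : Reach G s t P Q)
    (h' : Reach G s t' Q R) : Reach G s (t + t') P R := by
  obtain ⟨f, f0, ft, fs, fc⟩ := h
  obtain ⟨g, g0, gt, gs, gc⟩ := h'
  refine ⟨fun i => if i ≤ t then f i else g (i - t), by simpa using f0, ?_, fun i hi => ?_,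
    fun i hi => ?_⟩
  · by_cases h : t' = 0
    · subst h; simp [ft, ← gt, g0]
    · simp [h, gt]
  · rcases lt_trichotomy i t with h | rfl | h
    · simpa [h.le, Nat.succ_le_of_lt h] using fs i h
    · have := gs 0 (by omega)
      simpa [ft, ← g0] using this
    · have := gs (i - t) (by omega)
      rw [show i - t + 1 = i + 1 - t by omega] at this
      simpa [show ¬ i ≤ t by omega, show ¬ i + 1 ≤ t by omega] using this
  · by_cases h : i ≤ t
    · simpa [h] using fc i h
    · simpa [h] using gc (i - t) (by omega)

theorem Reach.refl {s : ℕ} {P : Finset V} (h : P.card ≤ s) : Reach G s 0 P P :=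
  ⟨fun _ => P, rfl, rfl, fun i hi => absurd hi (Nat.not_lt_zero i), fun _ _ => h⟩

theorem Reach.mono {s s' t : ℕ} {P Q : Finset V} (h : Reach G s t P Q) (hs : s ≤ s') :
    Reach G s' t P Q := by
  obtain ⟨f, f0, ft, fs, fc⟩ := h
  exact ⟨f, f0, ft, fs, fun i hi => (fc i hi).trans hs⟩

/-- Additional pebbles that stay in place do not affect legality. -/
theorem Reach.union [DecidableEq V] {s t : ℕ} {P Q : Finset V} (h : Reach G s t P Q)
    (T : Finset V) : Reach G (s + T.card) t (P ∪ T) (Q ∪ T) := by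
  obtain ⟨f, f0, ft, fs, fc⟩ := h
  refine ⟨fun i => f i ∪ T, by simp [f0], by simp [ft], fun i hi x hx u hu => ?_, fun i hi =>
    (Finset.card_union_le _ _).trans (Nat.add_le_add_right (fc i hi) _)⟩
  have := fs i hi x (by simp only [Finset.mem_union] at hx; tauto) u hu
  simp [this]

/-- A set all of whose parents are pebbled or lie lower in the set is pebbled level by level. -/
theorem reach_union_of_depth [DecidableEq V] {B A : Finset V} {d : ℕ} (φ : V → ℕ)
    (hd : ∀ u ∈ A, φ u < d)
    (hA : ∀ u ∈ A, ∀ w, G.Adj w u → w ∈ B ∨ w ∈ A ∧ φ w < φ u) :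
    Reach G (B ∪ A).card d B (B ∪ A) := by
  refine ⟨fun i => B ∪ A.filter (φ · < i), by simp, ?_, fun i _ x hx u hu => ?_, fun i _ =>
    Finset.card_le_card (Finset.union_subset_union_right (Finset.filter_subset _ _))⟩
  · show B ∪ A.filter (φ · < d) = _
    rw [Finset.filter_true_of_mem hd]
  · simp only [Finset.mem_union, Finset.mem_filter] at hx ⊢
    have hxA : x ∈ A := by tauto
    have hxi : φ x ≤ i := by
      by_contra h
      have : ¬ φ x < i := by omega
      have : ¬ φ x < i + 1 := by omega
      tauto
    rcases hA x hxA u hu with h | ⟨h, h'⟩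
    · exact ⟨.inl h, .inl h⟩
    · exact ⟨.inr ⟨h, by omega⟩, .inr ⟨h, by omega⟩⟩

theorem spaceTimeComplexity_le_of_reach {s t : ℕ} {Q : Finset V} (hQ : (Q : Set V) = sinks G)
    (h : Reach G s t ∅ Q) : spaceTimeComplexity G ≤ (t * s : ℕ) := by
  obtain ⟨f, f0, ft, fs, fc⟩ := h
  let P : Pebbling G (sinks G) :=
    { time := t
      conf := f
      start := f0
      finish := by rw [ft, hQ]
      add_legal := by
        rintro i hi x ⟨hx, hx'⟩ u ⟨w, rfl, hu⟩
        exact (fs i hi w (.inr ⟨hx, hx'⟩) u hu).1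
      delete_legal := by
        rintro i hi x ⟨hx, hx'⟩ u ⟨w, rfl, hu⟩
        exact (fs i hi w (.inl ⟨hx, hx'⟩) u hu).1
      reversible := by
        rintro i hi u (⟨w, ⟨hx, hx'⟩, hu⟩ | ⟨w, ⟨hx, hx'⟩, hu⟩)
        · exact (fs i hi w (.inr ⟨hx, hx'⟩) u hu).2
        · exact (fs i hi w (.inl ⟨hx, hx'⟩) u hu).2 }
  refine (iInf_le _ P).trans ?_
  have : P.space ≤ s := Finset.sup_le fun i hi => fc i (Finset.mem_Icc.1 hi).2
  exact_mod_cast Nat.mul_le_mul_left t this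

end Reachability

/-! ### Ancestors outside a set -/

section Ancestors

variable {V : Type*} [Fintype V] (G : Digraph V) (S : Finset V)

open Classical in
/-- The nodes outside `S` with a path of length `j + 1` to `W` whose nodes, except possibly the
last one, avoid `S`. -/
noncomputable def ancestorLayer (W : Finset V) : ℕ → Finset V
  | 0 => Finset.univ.filter fun u => u ∉ S ∧ ∃ w ∈ W, G.Adj u w
  | j + 1 => Finset.univ.filter fun u => u ∉ S ∧ ∃ w ∈ ancestorLayer W j, G.Adj u w

open Classical in
/-- The starting nodes of paths of length `1, …, d` to `W` that avoid `S` before their end. -/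
noncomputable def ancestorsWithin (W : Finset V) (d : ℕ) : Finset V :=
  (Finset.range d).biUnion (ancestorLayer G S W)

variable {G S}

open Classical in
theorem card_parents_le (hG : ∀ v, (Finset.univ.filter fun u => G.Adj u v).card ≤ 2)
    (W : Finset V) :
    (Finset.univ.filter fun u => u ∉ S ∧ ∃ w ∈ W, G.Adj u w).card ≤ W.card * 2 := by
  refine (Finset.card_le_card ?_).trans
    (Finset.card_biUnion_le_card_mul W (fun v => Finset.univ.filter fun u => G.Adj u v) 2
      fun v _ => hG v)
  intro u hu
  simp only [Finset.mem_filter, Finset.mem_univ, true_and, Finset.mem_biUnion] at hu ⊢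
  exact hu.2

open Classical in
theorem card_ancestorLayer_le (hG : ∀ v, (Finset.univ.filter fun u => G.Adj u v).card ≤ 2)
    (W : Finset V) (j : ℕ) : (ancestorLayer G S W j).card ≤ W.card * 2 ^ (j + 1) := by
  induction j with
  | zero => simpa [ancestorLayer] using card_parents_le (S := S) hG W
  | succ j ih =>
    refine (card_parents_le hG _).trans ?_
    rw [pow_succ 2 (j + 1), ← mul_assoc]
    exact Nat.mul_le_mul_right 2 ih

open Classical in
theorem card_ancestorsWithin_le (hG : ∀ v, (Finset.univ.filter fun u => G.Adj u v).card ≤ 2)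
    (W : Finset V) (d : ℕ) : (ancestorsWithin G S W d).card ≤ W.card * 2 ^ (d + 1) := by
  refine Finset.card_biUnion_le.trans
    ((Finset.sum_le_sum fun j _ => card_ancestorLayer_le hG W j).trans ?_)
  rw [← Finset.mul_sum]
  refine Nat.mul_le_mul_left _ ?_
  simp_rw [pow_succ]
  rw [← Finset.sum_mul]
  exact Nat.mul_le_mul_right 2 (Nat.geomSum_lt le_rfl (by simp)).le

/-- Each edge followed backwards outside `S` lowers `φ` by at least one, so the layers with index
`d` or more are empty and truncating at `d` loses no ancestor. -/
theorem depth_ancestorLayer {φ : V → ℕ} {d : ℕ} (hd : ∀ v, φ v < d)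
    (hφ : ∀ u v, G.Adj u v → u ∉ S → v ∉ S → φ u < φ v) (W : Finset V) (j : ℕ) :
    ∀ u ∈ ancestorLayer G S W j, u ∉ S ∧ φ u + j < d := by
  induction j with
  | zero =>
    intro u hu
    simp only [ancestorLayer, Finset.mem_filter] at hu
    exact ⟨hu.2.1, hd u⟩
  | succ j ih =>
    intro u hu
    simp only [ancestorLayer, Finset.mem_filter] at hu
    obtain ⟨-, huS, w, hw, huw⟩ := hu
    have := hφ u w huw huS (ih w hw).1
    have := (ih w hw).2
    exact ⟨huS, by omega⟩

open Classical in
theorem notMem_of_mem_ancestorsWithin {φ : V → ℕ} {d : ℕ} (hd : ∀ v, φ v < d)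
    (hφ : ∀ u v, G.Adj u v → u ∉ S → v ∉ S → φ u < φ v) {W : Finset V} {u : V}
    (hu : u ∈ ancestorsWithin G S W d) : u ∉ S := by
  obtain ⟨j, -, hj⟩ := Finset.mem_biUnion.1 hu
  exact (depth_ancestorLayer hd hφ W j u hj).1

open Classical in
theorem mem_ancestorsWithin_of_adj_target {φ : V → ℕ} {d : ℕ} (hd : ∀ v, φ v < d)
    {W : Finset V} {u w : V} (hw : w ∈ W) (huw : G.Adj u w) (hu : u ∉ S) :
    u ∈ ancestorsWithin G S W d := by
  refine Finset.mem_biUnion.2 ⟨0, Finset.mem_range.2 ((Nat.zero_le _).trans_lt (hd u)), ?_⟩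
  simp only [ancestorLayer, Finset.mem_filter, Finset.mem_univ, true_and]
  exact ⟨hu, w, hw, huw⟩

open Classical in
theorem mem_ancestorsWithin_of_adj {φ : V → ℕ} {d : ℕ} (hd : ∀ v, φ v < d)
    (hφ : ∀ u v, G.Adj u v → u ∉ S → v ∉ S → φ u < φ v)
    {W : Finset V} {u w : V} (hw : w ∈ ancestorsWithin G S W d) (huw : G.Adj u w) (hu : u ∉ S) :
    u ∈ ancestorsWithin G S W d := by
  obtain ⟨j, -, hj⟩ := Finset.mem_biUnion.1 hw
  have hu' : u ∈ ancestorLayer G S W (j + 1) := by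
    simp only [ancestorLayer, Finset.mem_filter, Finset.mem_univ, true_and]
    exact ⟨hu, w, hj, huw⟩
  have := (depth_ancestorLayer hd hφ W (j + 1) u hu').2
  exact Finset.mem_biUnion.2 ⟨j + 1, Finset.mem_range.2 (by omega), hu'⟩

end Ancestors

/-! ### Pebbling a depth-reduced Argon2i graph block by block -/

section Blocks

variable {N : ℕ} (r : Node N → ℕ)

open Classical in
theorem card_argonGraph_parents_le (v : Node N) :
    (Finset.univ.filter fun u => (argonGraph r).Adj u v).card ≤ 2 := by
  have : (Finset.univ.filter fun u => (argonGraph r).Adj u v) =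
      (Finset.univ.filter fun u : Node N => (v : ℕ) = u + 1) ∪
        Finset.univ.filter fun u : Node N => (u : ℕ) = r v ∧ (u : ℕ) < v := by
    ext u
    simp [argonGraph]
  rw [this]
  refine (Finset.card_union_le _ _).trans (Nat.add_le_add (b := 1) (d := 1) ?_ ?_) <;>
  · rw [Finset.card_le_one]
    intro a ha b hb
    simp only [Finset.mem_filter, Finset.mem_univ, true_and] at ha hb
    ext
    omega

theorem argonGraph_adj_lt {u v : Node N} (h : (argonGraph r).Adj u v) : (u : ℕ) < v := by
  rcases h with h | h
  · omega
  · exact h.2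

theorem sinks_argonGraph (hN : 0 < N) :
    sinks (argonGraph r) = {⟨N, Finset.mem_Icc.2 ⟨hN, le_rfl⟩⟩} := by
  ext ⟨v, hv⟩
  have hv' := Finset.mem_Icc.1 hv
  simp only [sinks, Set.mem_ofPred_eq, Set.mem_singleton_iff, Subtype.mk.injEq]
  constructor
  · intro h
    by_contra hne
    exact h ⟨⟨v + 1, Finset.mem_Icc.2 ⟨by omega, by omega⟩⟩, .inl rfl⟩
  · rintro rfl ⟨⟨u, hu⟩, huv⟩
    exact absurd (argonGraph_adj_lt r huv) (Finset.mem_Icc.1 hu).2.not_gt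

/-- The nodes `k b + 1, …, (k + 1) b`. -/
def block (N b k : ℕ) : Finset (Node N) :=
  Finset.univ.filter fun v => k * b < (v : ℕ) ∧ (v : ℕ) ≤ (k + 1) * b

theorem card_block_le (b k : ℕ) : (block N b k).card ≤ b := by
  have : (block N b k).card ≤ (Finset.Ioc (k * b) ((k + 1) * b)).card :=
    Finset.card_le_card_of_injOn (fun v => (v : ℕ))
      (fun v hv => by simpa [block] using hv) Subtype.val_injective.injOn
  simpa [add_mul] using this

/-- One block is processed by pebbling the ancestors it needs, pebbling the block, unpebbling the
block outside `S`, and unpebbling the ancestors. -/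
theorem reach_block {S : Finset (Node N)} {φ : Node N → ℕ} {d b : ℕ}
    (hd : ∀ v, φ v < d)
    (hφ : ∀ u v, (argonGraph r).Adj u v → u ∉ S → v ∉ S → φ u < φ v) (k : ℕ) :
    Reach (argonGraph r) (S.card + b * 2 ^ (d + 1) + b) (d + b + b + d)
      (S.filter fun v : Node N => (v : ℕ) ≤ k * b) (S.filter fun v : Node N => (v : ℕ) ≤ (k + 1) * b) := by
  classical
  set A := (ancestorsWithin (argonGraph r) S (block N b k) d).filter
    (fun v : Node N => (v : ℕ) ≤ k * b) with hAdef
  set B := block N b k with hB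
  set S₀ := S.filter fun v : Node N => (v : ℕ) ≤ k * b with hS₀
  set S₁ := S.filter fun v : Node N => (v : ℕ) ≤ (k + 1) * b with hS₁
  have hkb : k * b ≤ (k + 1) * b := Nat.mul_le_mul_right b (Nat.le_succ k)
  have hS₀₁ : S₀ ⊆ S₁ := fun v hv => by
    simp only [hS₀, hS₁, Finset.mem_filter] at hv ⊢
    exact ⟨hv.1, hv.2.trans hkb⟩
  have hS₁S : S₁ ⊆ S := Finset.filter_subset _ _
  have hAcard : A.card ≤ b * 2 ^ (d + 1) :=
    (Finset.card_filter_le _ _).trans <|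
      (card_ancestorsWithin_le (card_argonGraph_parents_le r) _ _).trans
        (Nat.mul_le_mul_right _ (card_block_le b k))
  have hAclosed : ∀ u ∈ A, ∀ w, (argonGraph r).Adj w u → w ∈ S₀ ∨ w ∈ A ∧ φ w < φ u := by
    intro u hu w hwu
    have hlt := argonGraph_adj_lt r hwu
    simp only [hAdef, Finset.mem_filter] at hu
    by_cases hw : w ∈ S
    · exact .inl (Finset.mem_filter.2 ⟨hw, by omega⟩)
    · exact .inr ⟨Finset.mem_filter.2 ⟨mem_ancestorsWithin_of_adj hd hφ hu.1 hwu hw, by omega⟩,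
        hφ w u hwu hw (notMem_of_mem_ancestorsWithin hd hφ hu.1)⟩
  have hBclosed : ∀ v ∈ B, ∀ w, (argonGraph r).Adj w v → w ∈ S₀ ∪ A ∨ w ∈ B ∧ (w : ℕ) < v := by
    intro v hv w hwv
    have hlt := argonGraph_adj_lt r hwv
    by_cases hwk : (w : ℕ) ≤ k * b
    · refine .inl (Finset.mem_union.2 ?_)
      by_cases hw : w ∈ S
      · exact .inl (Finset.mem_filter.2 ⟨hw, hwk⟩)
      · exact .inr (Finset.mem_filter.2 ⟨mem_ancestorsWithin_of_adj_target hd hv hwv hw, hwk⟩)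
    · refine .inr ⟨?_, hlt⟩
      simp only [hB, block, Finset.mem_filter, Finset.mem_univ, true_and] at hv ⊢
      omega
  have hBpos : ∀ v ∈ B, (v : ℕ) - (k * b + 1) < b ∧ k * b + 1 ≤ (v : ℕ) := by
    intro v hv
    simp only [hB, block, Finset.mem_filter, Finset.mem_univ, true_and, add_mul, one_mul] at hv
    omega
  -- The same configuration seen from both ends: as the result of pebbling the block over `S₀ ∪ A`,
  -- and as the result of pebbling only `B \ S` over `S₁ ∪ A`. Reversing the second run keeps the
  -- nodes of `S`.
  have hunion : S₀ ∪ A ∪ B = S₁ ∪ A ∪ B \ S := by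
    ext v
    have h₁ : v ∈ S₁ ↔ v ∈ S₀ ∨ v ∈ B ∧ v ∈ S := by
      simp only [hS₀, hS₁, hB, block, Finset.mem_filter, Finset.mem_univ, true_and]
      by_cases h : v ∈ S
      · simp only [h, true_and, and_true]
        omega
      · simp [h]
    simp only [Finset.mem_union, Finset.mem_sdiff, h₁]
    tauto
  have hcardS₁ : S₁.card ≤ S.card := Finset.card_le_card hS₁S
  have hcardS₀ : S₀.card ≤ S.card := (Finset.card_le_card hS₀₁).trans hcardS₁
  have hcardB : B.card ≤ b := card_block_le b k
  have c₁ := Finset.card_union_le S₀ A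
  have c₂ := Finset.card_union_le (S₀ ∪ A) B
  have c₃ := Finset.card_union_le S₁ A
  have r₁ : Reach (argonGraph r) (S.card + b * 2 ^ (d + 1) + b) d S₀ (S₀ ∪ A) :=
    (reach_union_of_depth φ (fun u _ => hd u) hAclosed).mono (by omega)
  have r₂ : Reach (argonGraph r) (S.card + b * 2 ^ (d + 1) + b) b (S₀ ∪ A) (S₀ ∪ A ∪ B) := by
    refine (reach_union_of_depth (fun v : Node N => (v : ℕ) - (k * b + 1)) (fun v hv => (hBpos v hv).1)
      fun v hv w hwv => ?_).mono (by omega)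
    refine (hBclosed v hv w hwv).imp_right fun h => ⟨h.1, ?_⟩
    have := (hBpos w h.1).2
    omega
  have r₃ : Reach (argonGraph r) (S.card + b * 2 ^ (d + 1) + b) b (S₁ ∪ A) (S₀ ∪ A ∪ B) := by
    rw [hunion]
    refine (reach_union_of_depth (fun v : Node N => (v : ℕ) - (k * b + 1))
      (fun v hv => (hBpos v (Finset.mem_sdiff.1 hv).1).1) fun v hv w hwv => ?_).mono
      (by rw [← hunion]; omega)
    rcases hBclosed v (Finset.mem_sdiff.1 hv).1 w hwv with h | ⟨h, h'⟩
    · exact .inl (Finset.union_subset_union_left hS₀₁ h)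
    · have := (hBpos w h).2
      by_cases hw : w ∈ S
      · refine .inl (Finset.mem_union_left _ (Finset.mem_filter.2 ⟨hw, ?_⟩))
        simp only [hB, block, Finset.mem_filter] at h
        exact h.2.2
      · exact .inr ⟨Finset.mem_sdiff.2 ⟨h, hw⟩, by omega⟩
  have r₄ : Reach (argonGraph r) (S.card + b * 2 ^ (d + 1) + b) d S₁ (S₁ ∪ A) :=
    (reach_union_of_depth φ (fun u _ => hd u)
      fun u hu w hw => (hAclosed u hu w hw).imp_left fun h => hS₀₁ h).mono (by omega)
  exact ((r₁.trans r₂).trans r₃.symm).trans r₄.symm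

theorem reach_blocks {S : Finset (Node N)} {φ : Node N → ℕ} {d b : ℕ}
    (hd : ∀ v, φ v < d)
    (hφ : ∀ u v, (argonGraph r).Adj u v → u ∉ S → v ∉ S → φ u < φ v) (k : ℕ) :
    Reach (argonGraph r) (S.card + b * 2 ^ (d + 1) + b) (k * (d + b + b + d))
      ∅ (S.filter fun v : Node N => (v : ℕ) ≤ k * b) := by
  induction k with
  | zero =>
    have : S.filter (fun v : Node N => (v : ℕ) ≤ 0 * b) = ∅ := by
      refine Finset.filter_false_of_mem fun v _ => ?_
      have := (Finset.mem_Icc.1 v.2).1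
      omega
    rw [this, zero_mul]
    exact Reach.refl (by simp)
  | succ k ih =>
    rw [add_mul, one_mul]
    exact ih.trans (reach_block r hd hφ k)

/-- A depth-reducing set `S` containing the sink yields a cheap quantum pebbling. -/
theorem spaceTimeComplexity_le_of_depthReducing (hN : 0 < N) {S : Finset (Node N)}
    {φ : Node N → ℕ} {d b : ℕ} (hb : 0 < b) (hd : ∀ v, φ v < d)
    (hφ : ∀ u v, (argonGraph r).Adj u v → u ∉ S → v ∉ S → φ u < φ v)
    (hS : ⟨N, Finset.mem_Icc.2 ⟨hN, le_rfl⟩⟩ ∈ S) :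
    spaceTimeComplexity (argonGraph r) ≤
      (4 * (N / b + 1) * (d + b) * (S.card + b * 2 ^ (d + 1) + b + 1) : ℕ) := by
  classical
  set n : Node N := ⟨N, Finset.mem_Icc.2 ⟨hN, le_rfl⟩⟩
  have h := reach_blocks r (S := S) (b := b) hd hφ (N / b + 1)
  rw [Finset.filter_true_of_mem fun v _ =>
    (Finset.mem_Icc.1 v.2).2.trans (by
      rw [mul_comm]; exact (Nat.lt_mul_div_succ N hb).le)] at h
  -- The reversed run clears `S` while one extra pebble stays on the sink. The forward and backward
  -- runs together give the factor 4.
  have h' := h.symm.union {n}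
  rw [Finset.union_eq_left.2 (Finset.singleton_subset_iff.2 hS), Finset.empty_union,
    Finset.card_singleton] at h'
  have := spaceTimeComplexity_le_of_reach (by simpa using (sinks_argonGraph r hN).symm)
    ((h.mono (Nat.le_add_right _ 1)).trans h')
  refine this.trans (le_of_eq ?_)
  congr 1
  ring

end Blocks

/-! ### A depth-reducing set -/

section DepthReducing

variable {N : ℕ} (r : Node N → ℕ)

/-- The nodes whose random parent is in the same layer of length `ℓ`. -/
def sameLayer (ℓ : ℕ) : Finset (Node N) :=
  Finset.univ.filter fun v => r v / ℓ = (v : ℕ) / ℓ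

theorem card_dvd_le (m : ℕ) :
    (Finset.univ.filter fun v : Node N => m ∣ (v : ℕ)).card ≤ N / m := by
  rw [← Nat.Ioc_filter_dvd_card_eq_div]
  exact Finset.card_le_card_of_injOn (fun v => (v : ℕ))
    (fun v hv => by
      have := Finset.mem_Icc.1 v.2
      simp only [Finset.coe_filter, Finset.mem_univ, true_and, Set.mem_ofPred_eq,
        Finset.mem_Ioc] at hv ⊢
      omega) Subtype.val_injective.injOn

theorem spaceTimeComplexity_le_of_layers (hN : 0 < N) {ℓ m q b : ℕ} (hm : 0 < m)
    (hb : 0 < b) (hq : N < q * ℓ) :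
    spaceTimeComplexity (argonGraph r) ≤
      (4 * (N / b + 1) * (q * m + b) *
        ((sameLayer r ℓ).card + N / m + 1 + b * 2 ^ (q * m + 1) + b + 1) : ℕ) := by
  classical
  set n : Node N := ⟨N, Finset.mem_Icc.2 ⟨hN, le_rfl⟩⟩
  set M := Finset.univ.filter fun v : Node N => m ∣ (v : ℕ)
  set S := sameLayer r ℓ ∪ M ∪ {n} with hS
  have hℓ : 0 < ℓ := Nat.pos_of_ne_zero fun h => by simp [h] at hq
  refine (spaceTimeComplexity_le_of_depthReducing r hN (S := S) (d := q * m)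
    -- Lexicographic rank: layer first, then position modulo `m`. A surviving edge `(i, i + 1)` does
    -- not wrap around modulo `m`, and a surviving random edge moves to a strictly later layer.
    (φ := fun v => (v : ℕ) / ℓ * m + (v : ℕ) % m) hb (fun v => ?_) (fun u v huv hu hv => ?_)
    (by simp [hS, n])).trans ?_
  · have h₁ : (v : ℕ) / ℓ < q :=
      (Nat.div_lt_iff_lt_mul hℓ).2 ((Finset.mem_Icc.1 v.2).2.trans_lt hq)
    have h₂ := Nat.mod_lt (v : ℕ) hm
    calc (v : ℕ) / ℓ * m + (v : ℕ) % m < ((v : ℕ) / ℓ + 1) * m := by rw [add_mul]; omega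
      _ ≤ q * m := Nat.mul_le_mul_right m h₁
  · have hlt := argonGraph_adj_lt r huv
    simp only [hS, M, sameLayer, Finset.mem_union, Finset.mem_filter, Finset.mem_univ, true_and,
      not_or] at hv
    have hle : (u : ℕ) / ℓ ≤ (v : ℕ) / ℓ := Nat.div_le_div_right hlt.le
    have hum := Nat.mod_lt (u : ℕ) hm
    rcases huv with h | h
    · have hmod : (v : ℕ) % m = (u : ℕ) % m + 1 := by
        have h1 : ((u : ℕ) + 1) % m ≠ 0 := fun h0 => hv.1.2 (h ▸ Nat.dvd_of_mod_eq_zero h0)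
        rw [h, Nat.add_mod]
        by_cases hm1 : m = 1
        · subst hm1; simp [Nat.mod_one] at h1
        · rw [Nat.mod_eq_of_lt (show 1 < m by omega)]
          refine Nat.mod_eq_of_lt (lt_of_le_of_ne hum fun h2 => h1 ?_)
          rw [Nat.add_mod, Nat.mod_eq_of_lt (show 1 < m by omega)]
          simp [show (u : ℕ) % m + 1 = m from h2]
      have := Nat.mul_le_mul_right m hle
      simp only [hmod]
      omega
    · have hlt' : (u : ℕ) / ℓ + 1 ≤ (v : ℕ) / ℓ :=
        lt_of_le_of_ne hle (h.1 ▸ hv.1.1)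
      have := Nat.mul_le_mul_right m hlt'
      rw [add_mul] at this
      omega
  · have hcard : S.card ≤ (sameLayer r ℓ).card + N / m + 1 := by
      refine (Finset.card_union_le _ _).trans (Nat.add_le_add ?_ (by simp))
      exact (Finset.card_union_le _ _).trans (Nat.add_le_add_left (card_dvd_le m) _)
    exact_mod_cast Nat.mul_le_mul_left _ (by omega)

end DepthReducing

end QuantumPebbling

namespace QuantumPebbling

/-! ### Cost in terms of the number of edges inside a layer -/

section Cost

variable {N : ℕ}

/-- Block length `√N + 1` dominates the depth, so the time is linear; since `4 ^ d ≤ √N`, the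
ancestor term is only `O(N / m)`. -/
theorem spaceTimeComplexity_le_card_sameLayer (r : Node N → ℕ) {ℓ m q : ℕ} (hm : 0 < m)
    (hq : N < q * ℓ) (hlog : 4 * (q * m) ≤ Nat.log 2 N) :
    (spaceTimeComplexity (argonGraph r) : ℝ≥0∞) ≤
      ENNReal.ofReal (24 * N * ((sameLayer r ℓ).card + 9 * (N / m))) := by
  have hq0 : 0 < q := Nat.pos_of_ne_zero fun h => by simp [h] at hq
  have hN : 0 < N := by
    by_contra h
    have : 0 < q * m := Nat.mul_pos hq0 hm
    have : N = 0 := by omega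
    subst this
    simp at hlog
    omega
  set d := q * m with hd
  set s := Nat.sqrt N with hs
  have hmd : m ≤ d := Nat.le_mul_of_pos_left m hq0
  have hss : s * s ≤ N := Nat.sqrt_le N
  have h4 : 4 ^ d ≤ s := by
    rw [hs, Nat.le_sqrt, ← pow_add, show (4 : ℕ) = 2 ^ 2 by norm_num, ← pow_mul,
      ← Nat.le_log_iff_pow_le (by norm_num) hN.ne']
    omega
  have hd2 : d < 2 ^ d := Nat.lt_two_pow_self
  have h24 : 2 ^ d * 2 ^ d = 4 ^ d := by rw [← mul_pow]; norm_num
  have h2s : 2 ^ d ≤ s :=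
    le_trans (by rw [← h24]; exact Nat.le_mul_of_pos_left _ (by positivity)) h4
  have hms : m ≤ s := by omega
  have hcost := spaceTimeComplexity_le_of_layers r hN (ℓ := ℓ) (b := s + 1) hm (Nat.succ_pos _) hq
  have hcost' : (spaceTimeComplexity (argonGraph r) : ℝ≥0∞) ≤
      ((4 * (N / (s + 1) + 1) * (q * m + (s + 1)) * ((sameLayer r ℓ).card + N / m + 1 +
        (s + 1) * 2 ^ (q * m + 1) + (s + 1) + 1) : ℕ) : ℝ≥0∞) := by
    have := ENat.toENNReal_le.2 hcost
    simpa using this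
  refine hcost'.trans ?_
  rw [← ENNReal.ofReal_natCast]
  refine ENNReal.ofReal_le_ofReal ?_
  rw [Nat.cast_mul]
  have hm' : (0 : ℝ) < m := by exact_mod_cast hm
  have htime : 4 * (N / (s + 1) + 1) * (q * m + (s + 1)) ≤ 24 * N := by
    have h1 : q * m + (s + 1) ≤ 2 * (s + 1) := by omega
    have h2 : N / (s + 1) * (s + 1) ≤ N := Nat.div_mul_le_self _ _
    have h3 : s + 1 ≤ 2 * N := by nlinarith
    calc 4 * (N / (s + 1) + 1) * (q * m + (s + 1))
        ≤ 4 * (N / (s + 1) + 1) * (2 * (s + 1)) := Nat.mul_le_mul_left _ h1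
      _ = 8 * (N / (s + 1) * (s + 1)) + 8 * (s + 1) := by ring
      _ ≤ 24 * N := by omega
  refine mul_le_mul (by exact_mod_cast htime) ?_ (by positivity) (by positivity)
  have hsm : (s : ℝ) ≤ N / m := by
    rw [le_div_iff₀ hm']
    exact_mod_cast (Nat.mul_le_mul_left s hms).trans hss
  have hs1' : (1 : ℝ) ≤ s := by exact_mod_cast (Nat.pos_of_ne_zero (by omega) : 0 < s)
  -- One factor `2 ^ d` pays for the ancestors, the other for `m ≤ d < 2 ^ d`.
  have hanc : ((s : ℝ) + 1) * 2 ^ (q * m + 1) ≤ 4 * (N / m) := by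
    rw [← mul_div_assoc, le_div_iff₀ hm']
    have : (s + 1) * 2 ^ (d + 1) * m ≤ 4 * N := by
      calc (s + 1) * 2 ^ (d + 1) * m ≤ (2 * s) * 2 ^ (d + 1) * 2 ^ d := by
            gcongr <;> omega
        _ = 4 * (s * 4 ^ d) := by rw [pow_succ, ← h24]; ring
        _ ≤ 4 * (s * s) := by gcongr
        _ ≤ 4 * N := by omega
    exact_mod_cast this
  have hdiv : ((N / m : ℕ) : ℝ) ≤ N / m := Nat.cast_div_le
  push_cast
  linarith

end Cost

/-! ### A Chernoff bound -/

section Chernoff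

/-- Upper tail of the number of independent events that occur. -/
theorem measureReal_pi_le_card_le {ι : Type*} [Fintype ι] {E : ι → Type*}
    [∀ i, MeasurableSpace (E i)] (μ : ∀ i, Measure (E i)) [∀ i, IsProbabilityMeasure (μ i)]
    (B : ∀ i, Set (E i)) (hB : ∀ i, MeasurableSet (B i)) [∀ i, DecidablePred (· ∈ B i)] (a : ℕ) :
    (Measure.pi μ).real {x | a ≤ (Finset.univ.filter fun i => x i ∈ B i).card} ≤
      Real.exp (∑ i, (μ i).real (B i)) / 2 ^ a := by
  -- Markov's inequality for `2 ^ X`, where `X` counts the events: the expectation factors by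
  -- independence into terms `1 + p ≤ exp p`.
  set f : ∀ i, E i → ℝ := fun i y => 1 + (B i).indicator (fun _ => 1) y with hf
  have hind : ∀ i, Integrable ((B i).indicator fun _ => (1 : ℝ)) (μ i) := fun i =>
    (integrable_const 1).indicator (hB i)
  have hint : ∀ i, Integrable (f i) (μ i) := fun i => (integrable_const 1).add (hind i)
  have hprod : ∀ x : ∀ i, E i, ∏ i, f i (x i) =
      2 ^ (Finset.univ.filter fun i => x i ∈ B i).card := by
    intro x
    rw [← Finset.prod_const, Finset.prod_filter]
    refine Finset.prod_congr rfl fun i _ => ?_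
    by_cases h : x i ∈ B i
    · simp only [hf, h, Set.indicator_of_mem, if_true]
      norm_num
    · simp [hf, h]
  have hmarkov := mul_meas_ge_le_integral_of_nonneg (μ := Measure.pi μ)
    (f := fun x => ∏ i, f i (x i)) (Eventually.of_forall fun x => by
      simp only [hprod]; positivity) (Integrable.fintype_prod_dep hint) (2 ^ a)
  rw [integral_fintype_prod_eq_prod] at hmarkov
  rw [le_div_iff₀ (by positivity), mul_comm]
  have hset : {x : ∀ i, E i | (2 : ℝ) ^ a ≤ ∏ i, f i (x i)} =
      {x | a ≤ (Finset.univ.filter fun i => x i ∈ B i).card} := by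
    ext x
    simp only [Set.mem_ofPred_eq, hprod]
    exact pow_le_pow_iff_right₀ (by norm_num)
  rw [hset] at hmarkov
  refine hmarkov.trans ?_
  rw [Real.exp_sum]
  refine Finset.prod_le_prod (fun i _ => integral_nonneg fun y => ?_) fun i _ => ?_
  · exact add_nonneg zero_le_one (Set.indicator_nonneg (fun _ _ => zero_le_one) y)
  · rw [hf, integral_add (integrable_const 1) (hind i), integral_indicator_const _ (hB i)]
    simpa [add_comm] using Real.add_one_le_exp ((μ i).real (B i))

/-- Exceeding the mean bound fourfold suffices because `4 log 2 > 2`. -/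
theorem exp_div_two_pow_ceil_le (M : ℝ) :
    Real.exp M / 2 ^ ⌈4 * M⌉₊ ≤ Real.exp (-M) := by
  rw [div_le_iff₀ (by positivity), ← Real.rpow_natCast, Real.rpow_def_of_pos (by norm_num),
    ← Real.exp_add, Real.exp_le_exp]
  have h1 := Nat.le_ceil (4 * M)
  have h2 := Real.log_two_gt_d9
  nlinarith

end Chernoff

/-! ### Random graphs with few edges inside a layer -/

section Random

variable {N : ℕ}

theorem one_sub_exp_le_measureReal_spaceTime (p : Node N → PMF ℕ) {ℓ m q : ℕ} (hm : 0 < m)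
    (hq : N < q * ℓ) (hlog : 4 * (q * m) ≤ Nat.log 2 N) {M D : ℝ}
    (hM : ∑ v : Node N, (p v).toMeasure.real {j | j / ℓ = (v : ℕ) / ℓ} ≤ M)
    (hD : 24 * N * (4 * M + 9 * (N / m)) ≤ D) :
    1 - Real.exp (-M) ≤ (Measure.pi fun v => (p v).toMeasure).real
      {r | (spaceTimeComplexity (argonGraph r) : ℝ≥0∞) ≤ ENNReal.ofReal D} := by
  have hM0 : 0 ≤ M := (Finset.sum_nonneg fun _ _ => measureReal_nonneg).trans hM
  set T : Set (Node N → ℕ) := {r | ⌈4 * M⌉₊ ≤ (sameLayer r ℓ).card}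
  have hT : (Measure.pi fun v => (p v).toMeasure).real T ≤ Real.exp (-M) := by
    have := measureReal_pi_le_card_le (fun v => (p v).toMeasure)
      (fun v : Node N => {j | j / ℓ = (v : ℕ) / ℓ}) (fun _ => .of_discrete) ⌈4 * M⌉₊
    refine this.trans ((div_le_div_of_nonneg_right (Real.exp_le_exp.2 hM) (by positivity)).trans
      (exp_div_two_pow_ceil_le M))
  have hTc := probReal_compl_eq_one_sub (μ := Measure.pi fun v => (p v).toMeasure) (s := T)
    .of_discrete
  refine le_trans (by linarith) (measureReal_mono (s₁ := Tᶜ) fun r hr => ?_)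
  refine (spaceTimeComplexity_le_card_sameLayer r hm hq hlog).trans
    (ENNReal.ofReal_le_ofReal (le_trans ?_ hD))
  have hr' : ((sameLayer r ℓ).card : ℝ) < 4 * M := by
    simpa [T, Nat.lt_ceil] using hr
  gcongr

/-- In Argon2i-A the parent of `v` is in the layer of `v` with probability at most `ℓ / v`. -/
theorem argonALaw_sameLayer_le {ℓ v : ℕ} (hℓ : 0 < ℓ) (hv : ℓ ≤ v) :
    (argonALaw v).toMeasure.real {j | j / ℓ = v / ℓ} ≤ ℓ / v := by
  have hvℓ : 0 < v / ℓ := Nat.div_pos hv hℓ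
  have hmod := Nat.mod_lt v hℓ
  have hdm := Nat.div_add_mod v ℓ
  unfold argonALaw
  split_ifs with h
  · have hv3 : 3 ≤ v := by
      obtain ⟨x, hx⟩ := h
      have := Finset.mem_Icc.1 hx
      omega
    rw [Measure.real, PMF.toMeasure_uniformOfFinset_apply _ _ .of_discrete, ENNReal.toReal_div]
    simp only [ENNReal.toReal_natCast, Nat.card_Icc, Set.mem_ofPred_eq]
    -- The layer of `v` starts at `ℓ * (v / ℓ)` and the parent is at most `v - 2`, leaving `v % ℓ -
    -- 1` candidates. Then `(ℓ - 2) / (v - 2) ≤ ℓ / v` because `ℓ ≤ v`.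
    have hcard : ((Finset.Icc 1 (v - 2)).filter fun j => j / ℓ = v / ℓ).card ≤ ℓ - 2 := by
      have hsub : ((Finset.Icc 1 (v - 2)).filter fun j => j / ℓ = v / ℓ) ⊆
          Finset.Icc (ℓ * (v / ℓ)) (v - 2) := fun j hj => by
        simp only [Finset.mem_filter, Finset.mem_Icc] at hj ⊢
        exact ⟨hj.2 ▸ Nat.mul_div_le j ℓ, hj.1.2⟩
      have := Finset.card_le_card hsub
      rw [Nat.card_Icc] at this
      omega
    have hvr : (0 : ℝ) < v := by positivity
    have hv2 : (0 : ℝ) < ((v - 2 + 1 - 1 : ℕ) : ℝ) := by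
      exact_mod_cast (by omega : 0 < v - 2 + 1 - 1)
    rw [div_le_div_iff₀ hv2 hvr]
    have : (ℓ - 2) * v ≤ ℓ * (v - 2 + 1 - 1) := by
      rw [show v - 2 + 1 - 1 = v - 2 by omega, Nat.sub_mul, Nat.mul_sub]
      omega
    exact_mod_cast (Nat.mul_le_mul_right v hcard).trans this
  -- The default value 0 lies in layer 0, whereas `v` lies in a later one.
  · have : (PMF.pure 0 : PMF ℕ).toMeasure {j | j / ℓ = v / ℓ} = 0 := by
      rw [PMF.toMeasure_pure_apply _ _ .of_discrete, if_neg]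
      simp only [Set.mem_ofPred_eq, Nat.zero_div]
      omega
    rw [Measure.real, this]
    simp only [ENNReal.toReal_zero]
    positivity

/-- The definition first casts the uniform integer to a real and then maps; the two maps are fused
here. -/
theorem argonBLaw_eq_map (v : Node N) :
    argonBLaw v = (PMF.uniformOfFinset (Finset.Icc 1 N) (Finset.nonempty_def.2 ⟨v, v.2⟩)).map
      fun x : ℕ => ⌈((v : ℕ) : ℝ) * (1 - (x : ℝ) ^ 2 / (N : ℝ) ^ 2)⌉₊ :=
  PMF.map_comp (fun x : ℕ => (x : ℝ)) (PMF.uniformOfFinset (Finset.Icc 1 N) (Finset.nonempty_def.2 ⟨v, v.2⟩))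
    fun x : ℝ => ⌈((v : ℕ) : ℝ) * (1 - x ^ 2 / (N : ℝ) ^ 2)⌉₊

/-- In Argon2i-B the parent of `v` is in the layer of `v` with probability at most
`√(ℓ / v)`. -/
theorem argonBLaw_sameLayer_le {ℓ : ℕ} (hℓ : 0 < ℓ) (v : Node N) :
    (argonBLaw v).toMeasure.real {j | j / ℓ = (v : ℕ) / ℓ} ≤ √(ℓ / (v : ℕ)) := by
  obtain ⟨hv1, hvN⟩ := Finset.mem_Icc.1 v.2
  have hv0 : (0 : ℝ) < (v : ℕ) := by exact_mod_cast hv1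
  have hN0 : (0 : ℝ) < N := by exact_mod_cast hv1.trans hvN
  have hmod := Nat.mod_lt (v : ℕ) hℓ
  have hdm := Nat.div_add_mod (v : ℕ) ℓ
  rw [argonBLaw_eq_map, Measure.real, PMF.toMeasure_map_apply _ _ _ measurable_from_top .of_discrete,
    PMF.toMeasure_uniformOfFinset_apply _ _ .of_discrete, ENNReal.toReal_div]
  simp only [ENNReal.toReal_natCast, Nat.card_Icc, Set.mem_ofPred_eq, Set.mem_preimage,
    Nat.add_sub_cancel]
  rw [div_le_iff₀ hN0]
  have hsub : ((Finset.Icc 1 N).filter fun x : ℕ =>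
      ⌈((v : ℕ) : ℝ) * (1 - (x : ℝ) ^ 2 / (N : ℝ) ^ 2)⌉₊ / ℓ = (v : ℕ) / ℓ) ⊆
      Finset.Icc 1 ⌊√(ℓ / (v : ℕ)) * N⌋₊ := by
    intro x hx
    simp only [Finset.mem_filter, Finset.mem_Icc] at hx ⊢
    refine ⟨hx.1.1, Nat.le_floor ?_⟩
    have hxN : (x : ℝ) ≤ N := by exact_mod_cast hx.1.2
    set y : ℝ := ((v : ℕ) : ℝ) * (1 - (x : ℝ) ^ 2 / (N : ℝ) ^ 2) with hy
    have hy0 : 0 ≤ y := by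
      refine mul_nonneg hv0.le (sub_nonneg.2 ?_)
      rw [div_le_one (by positivity)]
      gcongr
    have hceil : (⌈y⌉₊ : ℝ) < y + 1 := Nat.ceil_lt_add_one hy0
    have hle : ℓ * ((v : ℕ) / ℓ) ≤ ⌈y⌉₊ := hx.2 ▸ Nat.mul_div_le _ ℓ
    have hge : (v : ℕ) + 1 ≤ ⌈y⌉₊ + ℓ := by omega
    have hge' : ((v : ℕ) : ℝ) + 1 ≤ ⌈y⌉₊ + ℓ := by exact_mod_cast hge
    -- A parent in the layer of `v` forces `v - y < ℓ`, and `v - y` is exactly `v (x / N)²`.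
    have hsq : ((v : ℕ) : ℝ) * ((x : ℝ) / N) ^ 2 ≤ ℓ := by
      rw [div_pow]
      have : y = (v : ℕ) - ((v : ℕ) : ℝ) * ((x : ℝ) ^ 2 / (N : ℝ) ^ 2) := by rw [hy]; ring
      linarith
    rw [← div_le_iff₀ hN0]
    refine Real.le_sqrt_of_sq_le ?_
    rw [le_div_iff₀ hv0, mul_comm]
    exact hsq
  calc _ ≤ ((Finset.Icc 1 ⌊√(ℓ / (v : ℕ)) * N⌋₊).card : ℝ) := by
        exact_mod_cast Finset.card_le_card hsub
    _ ≤ _ := by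
      rw [Nat.card_Icc, Nat.add_sub_cancel]
      exact Nat.floor_le (by positivity)

/-- The first `ℓ` terms contribute at most `ℓ`; afterwards `1 / (n + 1) ≤ log ((n + 1) / n)`
telescopes. -/
theorem sum_le_mul_one_add_log {ℓ : ℕ} (hℓ : 0 < ℓ) {f : ℕ → ℝ} (h1 : ∀ v, f v ≤ 1)
    (hf : ∀ v, ℓ ≤ v → f v ≤ ℓ / v) {n : ℕ} (hn : ℓ ≤ n) :
    ∑ v ∈ Finset.Icc 1 n, f v ≤ ℓ * (1 + Real.log (n / ℓ)) := by
  have hℓ' : (0 : ℝ) < ℓ := by exact_mod_cast hℓ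
  induction n, hn using Nat.le_induction with
  | base =>
    rw [div_self hℓ'.ne', Real.log_one, add_zero, mul_one]
    simpa using Finset.sum_le_card_nsmul (Finset.Icc 1 ℓ) f 1 fun v _ => h1 v
  | succ n hn ih =>
    have hn' : (0 : ℝ) < n := by exact_mod_cast hℓ.trans_le hn
    rw [Finset.sum_Icc_succ_top (by omega)]
    have h2 := hf (n + 1) (by omega)
    have h3 := Real.one_sub_inv_le_log_of_pos (x := ((n : ℝ) + 1) / n) (by positivity)
    have h4 : Real.log (((n + 1 : ℕ) : ℝ) / ℓ) =
        Real.log (n / ℓ) + Real.log (((n : ℝ) + 1) / n) := by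
      rw [← Real.log_mul (by positivity) (by positivity)]
      congr 1
      push_cast
      field_simp
    have h5 : (ℓ : ℝ) / ((n + 1 : ℕ) : ℝ) = ℓ * (1 - (((n : ℝ) + 1) / n)⁻¹) := by
      push_cast
      field_simp
      ring
    rw [h4]
    rw [h5] at h2
    nlinarith [mul_le_mul_of_nonneg_left h3 hℓ'.le]

/-- Telescoping of `1 / √(n + 1) ≤ 2 (√(n + 1) - √n)`. -/
theorem sum_inv_sqrt_le (n : ℕ) : ∑ v ∈ Finset.Icc 1 n, (√(v : ℝ))⁻¹ ≤ 2 * √n := by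
  induction n with
  | zero => simp
  | succ n ih =>
    rw [Finset.sum_Icc_succ_top (by omega)]
    have h0 : 0 < √((n + 1 : ℕ) : ℝ) := Real.sqrt_pos.2 (by positivity)
    have h1 := Real.sq_sqrt (show (0 : ℝ) ≤ n by positivity)
    have h2 := Real.sq_sqrt (show (0 : ℝ) ≤ (n + 1 : ℕ) by positivity)
    push_cast at h0 h1 h2 ⊢
    have : (√((n : ℝ) + 1))⁻¹ ≤ 2 * √((n : ℝ) + 1) - 2 * √n := by
      rw [inv_le_iff_one_le_mul₀ h0]
      nlinarith [sq_nonneg (√((n : ℝ) + 1) - √n)]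
    linarith

theorem sum_node {N : ℕ} (f : ℕ → ℝ) : ∑ v : Node N, f v = ∑ v ∈ Finset.Icc 1 N, f v :=
  Finset.sum_coe_sort (Finset.Icc 1 N) f

theorem sum_argonALaw_sameLayer_le {ℓ : ℕ} (hℓ : 0 < ℓ) (hN : ℓ ≤ N) :
    ∑ v : Node N, (argonALaw v).toMeasure.real {j | j / ℓ = (v : ℕ) / ℓ} ≤
      ℓ * (1 + Real.log (N / ℓ)) := by
  rw [sum_node fun v => (argonALaw v).toMeasure.real {j | j / ℓ = v / ℓ}]
  exact sum_le_mul_one_add_log hℓ (fun v => measureReal_le_one)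
    (fun v hv => argonALaw_sameLayer_le hℓ hv) hN

theorem sum_argonBLaw_sameLayer_le {ℓ : ℕ} (hℓ : 0 < ℓ) :
    ∑ v : Node N, (argonBLaw v).toMeasure.real {j | j / ℓ = (v : ℕ) / ℓ} ≤ 2 * √(ℓ * N) := by
  refine (Finset.sum_le_sum fun v _ => argonBLaw_sameLayer_le hℓ v).trans ?_
  rw [sum_node fun v => √((ℓ : ℝ) / v)]
  simp_rw [Real.sqrt_div (Nat.cast_nonneg ℓ), div_eq_mul_inv]
  rw [← Finset.mul_sum, Real.sqrt_mul (Nat.cast_nonneg ℓ)]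
  nlinarith [sum_inv_sqrt_le N, Real.sqrt_nonneg (ℓ : ℝ)]

end Random

end QuantumPebbling

namespace QuantumPebbling

/-! ### Choice of the parameters -/

section Parameters

theorem eventually_exp_neg_sqrt_le_rpow (c : ℝ) :
    ∀ᶠ N : ℕ in atTop, Real.exp (-√(N : ℝ)) ≤ (N : ℝ) ^ (-c) := by
  have h := (tendsto_rpow_mul_exp_neg_mul_atTop_nhds_zero (2 * c) 1 one_pos).comp
    (Real.tendsto_sqrt_atTop.comp tendsto_natCast_atTop_atTop)
  filter_upwards [h.eventually (gt_mem_nhds one_pos), eventually_gt_atTop 0] with N hN hN0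
  have hN' : (0 : ℝ) < N := by exact_mod_cast hN0
  simp only [Function.comp_apply, neg_mul, one_mul] at hN
  rw [Real.sqrt_eq_rpow, ← Real.rpow_mul hN'.le,
    show (1 / 2 : ℝ) * (2 * c) = c by ring, ← Real.sqrt_eq_rpow] at hN
  rw [Real.rpow_neg hN'.le, ← one_div, le_div_iff₀ (Real.rpow_pos_of_pos hN' c), mul_comm]
  exact hN.le

/-- An integer `m ≥ 1` with `4 m ^ k ≤ log N` and `log N ≤ 4 (2 m) ^ k`. -/
theorem exists_pow_le_log {N k : ℕ} (hk : k ≠ 0) (hN : 16 ≤ N) :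
    ∃ m : ℕ, 0 < m ∧ 4 * m ^ k ≤ Nat.log 2 N ∧ Real.logb 2 N ≤ 4 * (2 * m) ^ k := by
  set L := Nat.log 2 N with hL
  have hL4 : 4 ≤ L := (Nat.le_log_iff_pow_le (by norm_num) (by omega)).2 (by simpa using hN)
  set m := Nat.nthRoot k (L / 4) with hm
  have h1 : m ^ k ≤ L / 4 := Nat.pow_nthRoot_le (.inl hk)
  have h2 : L / 4 < (m + 1) ^ k := Nat.lt_pow_nthRoot_add_one hk _
  have hm0 : 0 < m := by
    by_contra h
    have : m = 0 := by omega
    rw [this, zero_add, one_pow] at h2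
    omega
  refine ⟨m, hm0, by omega, ?_⟩
  have h3 : (m + 1) ^ k ≤ (2 * m) ^ k := Nat.pow_le_pow_left (by omega) k
  have h4 : L + 1 ≤ 4 * (2 * m) ^ k := by omega
  have h5 : Real.logb 2 N ≤ (L + 1 : ℕ) := by
    rw [Real.logb_le_iff_le_rpow (by norm_num) (by positivity), Real.rpow_natCast]
    exact_mod_cast (Nat.lt_pow_succ_log_self (by norm_num) N).le
  exact h5.trans (by exact_mod_cast h4)

theorem natLog_le_logb {N : ℕ} (hN : 0 < N) : (Nat.log 2 N : ℝ) ≤ Real.logb 2 N := by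
  rw [Real.le_logb_iff_rpow_le (by norm_num) (by positivity), Real.rpow_natCast]
  exact_mod_cast Nat.pow_log_le_self 2 hN.ne'

theorem sq_le_of_le_log {N m : ℕ} (hN : 0 < N) (h : 2 * m ≤ Nat.log 2 N) : m * m ≤ N := by
  have h1 : m < 2 ^ m := Nat.lt_two_pow_self
  calc m * m ≤ 2 ^ m * 2 ^ m := Nat.mul_le_mul h1.le h1.le
    _ = 2 ^ (2 * m) := by rw [← pow_add, two_mul]
    _ ≤ N := (Nat.le_log_iff_pow_le (by norm_num) hN.ne').1 h

theorem sqrt_le_div {N m : ℕ} (hm : 0 < m) (h : m * m ≤ N) : √(N : ℝ) ≤ N / m := by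
  have hm' : (0 : ℝ) < m := by exact_mod_cast hm
  rw [le_div_iff₀ hm']
  have h1 : (m : ℝ) ≤ √N := Real.le_sqrt_of_sq_le (by rw [pow_two]; exact_mod_cast h)
  calc √(N : ℝ) * m ≤ √N * √N := by gcongr
    _ = N := Real.mul_self_sqrt (Nat.cast_nonneg N)

theorem layer_length_le {N q : ℕ} (hq : 0 < q) (h : q ≤ N) :
    ((N / q + 1 : ℕ) : ℝ) ≤ 2 * (N / q) := by
  have hq' : (0 : ℝ) < q := by exact_mod_cast hq
  have h1 : ((N / q : ℕ) : ℝ) ≤ N / q := Nat.cast_div_le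
  have h2 : (1 : ℝ) ≤ N / q := by
    rw [le_div_iff₀ hq', one_mul]
    exact_mod_cast h
  push_cast
  linarith

theorem whp_argonA : WithHighProbability argonA fun N =>
    {r | (spaceTimeComplexity (argonGraph r) : ℝ≥0∞) ≤ ENNReal.ofReal
      (1728 * ((N : ℝ) ^ 2 * Real.logb 2 (Real.logb 2 N) / √(Real.logb 2 N)))} := by
  intro c _
  -- The threshold makes `log N` exceed 16, which rules out `m = 1` and so ensures `ℓ ≤ N`.
  filter_upwards [eventually_exp_neg_sqrt_le_rpow c, eventually_ge_atTop (2 ^ 17)] with N hexp hN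
  obtain ⟨m, hm, hlog, hup⟩ := exists_pow_le_log (k := 2) two_ne_zero (by omega : 16 ≤ N)
  have hm' : (1 : ℝ) ≤ m := by exact_mod_cast hm
  have hN0 : (0 : ℝ) < N := by positivity
  have hmm : m * m ≤ N := sq_le_of_le_log (by omega) (by nlinarith)
  have hmN : m ≤ N := by nlinarith
  have hNm : √(N : ℝ) ≤ N / m := sqrt_le_div hm hmm
  set x := Real.logb 2 N with hx
  set ℓ := N / m + 1 with hℓ
  have hx17 : 17 ≤ x := by
    rw [hx, Real.le_logb_iff_rpow_le (by norm_num) hN0]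
    exact_mod_cast hN
  have hx4 : 4 ≤ x := by linarith
  have hm2 : 2 ≤ m := by
    by_contra h
    obtain rfl : m = 1 := by omega
    norm_num at hup
    linarith
  have hxx : 2 ≤ Real.logb 2 x := by
    rw [Real.le_logb_iff_rpow_le (by norm_num) (by linarith)]
    norm_num
    exact hx4
  have hsqrt : √x ≤ 4 * m := by
    rw [Real.sqrt_le_left (by positivity)]
    nlinarith
  have hmx : (m : ℝ) ≤ x := by
    have h1 := natLog_le_logb (N := N) (by omega)
    have h2 : ((4 * m ^ 2 : ℕ) : ℝ) ≤ Nat.log 2 N := by exact_mod_cast hlog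
    push_cast at h2
    nlinarith
  have hlogm0 : 0 ≤ Real.log m := Real.log_nonneg hm'
  have hlogm : Real.log m ≤ Real.logb 2 x := by
    refine (Real.log_le_log (by linarith) hmx).trans ?_
    rw [Real.logb, le_div_iff₀ (Real.log_pos one_lt_two)]
    nlinarith [Real.log_two_lt_d9, Real.log_nonneg (show 1 ≤ x by linarith)]
  have hℓN : ℓ ≤ N := by
    have : N / m ≤ N / 2 := Nat.div_le_div_left hm2 two_pos
    omega
  have hq : N < m * ℓ := Nat.lt_mul_div_succ N hm
  have hℓ0 : (0 : ℝ) < ℓ := by positivity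
  have hℓm : (ℓ : ℝ) ≤ 2 * (N / m) := layer_length_le hm hmN
  have hratio : (N : ℝ) / ℓ ≤ m := by
    rw [div_le_iff₀ hℓ0]
    exact_mod_cast hq.le
  have hNm0 : 0 ≤ (N : ℝ) / m := by positivity
  have hM : ∑ v : Node N, (argonALaw v).toMeasure.real {j | j / ℓ = (v : ℕ) / ℓ} ≤
      2 * (N / m) * (1 + Real.log m) := by
    refine (sum_argonALaw_sameLayer_le (Nat.succ_pos _) hℓN).trans ?_
    have := Real.log_le_log (by positivity) hratio
    calc (ℓ : ℝ) * (1 + Real.log (N / ℓ)) ≤ ℓ * (1 + Real.log m) := by gcongr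
      _ ≤ 2 * (N / m) * (1 + Real.log m) := by gcongr
  refine le_trans ?_ (one_sub_exp_le_measureReal_spaceTime (fun v : Node N => argonALaw v) hm hq
    (by rwa [← pow_two]) hM ?_)
  · have : Real.exp (-(2 * (N / m) * (1 + Real.log m))) ≤ Real.exp (-√(N : ℝ)) := by
      rw [Real.exp_le_exp]
      nlinarith [mul_nonneg hNm0 hlogm0]
    linarith
  · have hx0 : 0 < √x := Real.sqrt_pos.2 (by linarith)
    have hinv : (N : ℝ) / m ≤ 4 * N / √x := by
      rw [div_le_div_iff₀ (by linarith) hx0]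
      nlinarith
    -- Here `17 + 8 log m` is absorbed using `log log N ≥ 2`, and `24 * 4 * 18 = 1728`.
    calc 24 * (N : ℝ) * (4 * (2 * (N / m) * (1 + Real.log m)) + 9 * (N / m))
        = 24 * N * (N / m) * (17 + 8 * Real.log m) := by ring
      _ ≤ 24 * N * (4 * N / √x) * (18 * Real.logb 2 x) := by
          gcongr
          linarith
      _ = 1728 * ((N : ℝ) ^ 2 * Real.logb 2 x / √x) := by ring

theorem whp_argonB : WithHighProbability argonB fun N =>
    {r | (spaceTimeComplexity (argonGraph r) : ℝ≥0∞) ≤ ENNReal.ofReal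
      (2016 * ((N : ℝ) ^ 2 / (Real.logb 2 N) ^ (1 / 3 : ℝ)))} := by
  intro c _
  filter_upwards [eventually_exp_neg_sqrt_le_rpow c, eventually_ge_atTop 16] with N hexp hN
  obtain ⟨m, hm, hlog, hup⟩ := exists_pow_le_log (k := 3) three_ne_zero hN
  have hm' : (1 : ℝ) ≤ m := by exact_mod_cast hm
  have hN0 : (0 : ℝ) < N := by positivity
  have hmm : m * m ≤ N := by
    refine sq_le_of_le_log (by omega) (le_trans ?_ hlog)
    have := Nat.le_self_pow three_ne_zero m
    omega
  have hNm : √(N : ℝ) ≤ N / m := sqrt_le_div hm hmm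
  have hNm0 : 0 ≤ (N : ℝ) / m := by positivity
  set x := Real.logb 2 N with hx
  set ℓ := N / m ^ 2 + 1 with hℓ
  have hx0 : 0 < x := Real.logb_pos one_lt_two (by exact_mod_cast (by omega : 1 < N))
  have hcbrt : x ^ (1 / 3 : ℝ) ≤ 4 * m := by
    refine (Real.rpow_le_rpow hx0.le
      (show x ≤ (4 * (m : ℝ)) ^ (3 : ℕ) from hup.trans ?_) (by norm_num)).trans_eq ?_
    · nlinarith [pow_pos (zero_lt_one.trans_le hm') 3]
    · rw [← Real.rpow_natCast, ← Real.rpow_mul (by positivity)]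
      norm_num
  have hq : N < m ^ 2 * ℓ := Nat.lt_mul_div_succ N (by positivity)
  have hℓm : (ℓ : ℝ) ≤ 2 * (N / m ^ 2) := by
    have := layer_length_le (N := N) (q := m ^ 2) (by positivity) (by rwa [pow_two])
    exact_mod_cast this
  -- With `ℓ ≤ 2 N / m²` the mean is at most `2 √2 N / m`, rounded up to `3 N / m`.
  have hM : ∑ v : Node N, (argonBLaw v).toMeasure.real {j | j / ℓ = (v : ℕ) / ℓ} ≤
      3 * (N / m) := by
    refine (sum_argonBLaw_sameLayer_le (Nat.succ_pos _)).trans ?_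
    have : √((ℓ : ℝ) * N) ≤ 3 / 2 * (N / m) := by
      rw [Real.sqrt_le_left (by positivity)]
      calc (ℓ : ℝ) * N ≤ 2 * (N / m ^ 2) * N := by gcongr
        _ = 2 * (N / m) ^ 2 := by ring
        _ ≤ (3 / 2 * (N / m)) ^ 2 := by nlinarith [sq_nonneg ((N : ℝ) / m)]
    linarith
  refine le_trans ?_ (one_sub_exp_le_measureReal_spaceTime argonBLaw hm hq
    (by rwa [← pow_succ]) hM ?_)
  · have : Real.exp (-(3 * ((N : ℝ) / m))) ≤ Real.exp (-√(N : ℝ)) := by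
      rw [Real.exp_le_exp]
      linarith
    linarith
  · have hy0 : 0 < x ^ (1 / 3 : ℝ) := Real.rpow_pos_of_pos hx0 _
    have hinv : (N : ℝ) / m ≤ 4 * N / x ^ (1 / 3 : ℝ) := by
      rw [div_le_div_iff₀ (by linarith) hy0]
      nlinarith
    calc 24 * (N : ℝ) * (4 * (3 * (N / m)) + 9 * (N / m)) = 504 * N * (N / m) := by ring
      _ ≤ 504 * N * (4 * N / x ^ (1 / 3 : ℝ)) := by gcongr
      _ = 2016 * ((N : ℝ) ^ 2 / x ^ (1 / 3 : ℝ)) := by ring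

end Parameters

end QuantumPebbling

theorem mainTheorem4 :
    (∃ C : ℝ, 0 < C ∧
      QuantumPebbling.WithHighProbability QuantumPebbling.argonA fun N =>
        {r | (QuantumPebbling.spaceTimeComplexity (QuantumPebbling.argonGraph r) : ℝ≥0∞) ≤
          ENNReal.ofReal
            (C * ((N : ℝ) ^ 2 * Real.logb 2 (Real.logb 2 N) / √(Real.logb 2 N)))}) ∧
    (∃ C : ℝ, 0 < C ∧
      QuantumPebbling.WithHighProbability QuantumPebbling.argonB fun N =>
        {r | (QuantumPebbling.spaceTimeComplexity (QuantumPebbling.argonGraph r) : ℝ≥0∞) ≤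
          ENNReal.ofReal
            (C * ((N : ℝ) ^ 2 / (Real.logb 2 N) ^ (1 / 3 : ℝ)))}) := by
  exact ⟨⟨1728, by norm_num, QuantumPebbling.whp_argonA⟩,
    ⟨2016, by norm_num, QuantumPebbling.whp_argonB⟩⟩
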